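/- Let $K$ be a field of characteristic zero; an operator is a $K$-linear endomorphism of $K[x]$, products of operators are compositions, $\mathbf{x}$ is the operator of multiplication by $x$, $D=\frac{d}{dx}$, and $E^a p(x)=p(x+a)$. A delta operator is an operator $Q$ that commutes with all $E^a$ ($a\in K$) and for which $Qx$ is a nonzero constant. Write $\phi\leadsto Q$ if $Q$ is a delta operator and $\phi$ is an invertible operator such that $\phi_n:=\phi x^n$ satisfies $Q\phi_n=n\phi_{n-1}$ for all $n\ge 0$ (with right-hand side $0$ for $n=0$), $\phi_0=1$, and $\phi_n(0)=0$ for $n>0$. For an operator $T$ put $T'=T\mathbf{x}-\mathbf{x}T$. For a formal power series $f=\sum_k a_kt^k$ put $f(Q)=\sum_k a_kQ^k$ (a finite sum on every polynomial), and let $\tilde Q\in K[[t]]$ be the series with $\tilde Q(D)=Q$, and $\tilde Q^{-1}$ its compositional inverse, with $j$-th formal derivative $(\tilde Q^{-1})^{(j)}$. The partial Bell polynomials $B_{n,k}(x_1,\dots,x_{n-k+1})$ are defined by $\frac1{k!}\bigl(\sum_{j\ge1}x_j\frac{t^j}{j!}\bigr)^k=\sum_{n\ge k}B_{n,k}(x_1,\dots,x_{n-k+1})\frac{t^n}{n!}$.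 If $\phi\leadsto Q$, then $Q'$ is invertible, $\tilde Q$ and its compositional inverse $\tilde Q^{-1}$ exist, and for every $n\in\mathbb{N}$ (including $n=0$) $$\phi\,\mathbf{x}^n=(\mathbf{x}(Q')^{-1})^n\phi=\sum_{k=0}^n\mathbf{x}^k\,B_{n,k}\bigl((\tilde Q^{-1})^{(1)}(Q),\dots,(\tilde Q^{-1})^{(n-k+1)}(Q)\bigr)\,\phi .$$ The Bell polynomials are evaluated at operators which commute with one another, being power series in $Q$. -/

import Mathlib

namespace Umbral

open Polynomial

noncomputable section

/-- Linear operators on the polynomials in one variable; the product is composition. -/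
abbrev Op (K : Type*) [Field K] := Module.End K K[X]

variable {K : Type*} [Field K]

/-- The derivative `D`. -/
def D : Op K := Polynomial.derivative

/-- Multiplication by the variable, `p(x) ↦ x p(x)`. -/
def mulX : Op K := LinearMap.mulLeft K (X : K[X])

/-- The shift `E^a`, `p(x) ↦ p(x + a)`. -/
def shift (a : K) : Op K := Polynomial.taylor a

/-- `U` commutes with every shift `E^a`. -/
def IsShiftInvariant (U : Op K) : Prop := ∀ a : K, U * shift a = shift a * U

/-- A delta operator: shift-invariant, and `Q x` is a nonzero constant. -/
structure IsDelta (Q : Op K) : Prop where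
  shiftInvariant : IsShiftInvariant Q
  map_X : ∃ c : K, c ≠ 0 ∧ Q X = C c

/-- `s` is a Sheffer operator for `Q`: it is invertible, and `s_n = s x^n` satisfies
`Q s_n = n s_{n-1}` (for `n = 0` this says `Q s_0 = 0`). -/
structure IsSheffer (s Q : Op K) : Prop where
  isUnit : IsUnit s
  map_seq : ∀ n : ℕ, Q (s (X ^ n)) = (n : K) • s (X ^ (n - 1))

/-- `φ ⇝ Q`: `φ` is the umbral operator of the delta operator `Q`. -/
structure IsUmbral (φ Q : Op K) : Prop where
  delta : IsDelta Q
  sheffer : IsSheffer φ Q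
  map_one : φ 1 = 1
  eval_zero : ∀ n : ℕ, 0 < n → (φ (X ^ n)).eval 0 = 0

/-- The Pincherle derivative `T' = T x - x T`. -/
def pincherle (T : Op K) : Op K := T * mulX - mulX * T

/-- `f(Q) = ∑ₖ aₖ Q^k` for a formal power series `f = ∑ₖ aₖ t^k`: the operator that sends `x^n` to
`∑ₖ aₖ Q^k x^n`, extended linearly. It is meant for operators `Q` such that every polynomial is
killed by a power of `Q` (delta operators, for instance); see `seriesAt_apply`. -/
def seriesAt (f : PowerSeries K) (Q : Op K) : Op K :=
  (Polynomial.basisMonomials K).constr K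
    fun n : ℕ => ∑ᶠ k : ℕ, PowerSeries.coeff k f • (Q ^ k) (X ^ n)

theorem seriesAt_X_pow (f : PowerSeries K) (Q : Op K) (n : ℕ) :
    seriesAt f Q (X ^ n) = ∑ᶠ k : ℕ, PowerSeries.coeff k f • (Q ^ k) (X ^ n) := by
  have h := (Polynomial.basisMonomials K).constr_basis K
    (fun n : ℕ => ∑ᶠ k : ℕ, PowerSeries.coeff k f • (Q ^ k) (X ^ n)) n
  simp only [Polynomial.coe_basisMonomials, Polynomial.monomial_one_right_eq_X_pow] at h
  exact h

/-- The sum that defines `f(Q) p` is finite for every `p` and gives the value of `f(Q)` at `p`. -/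
theorem seriesAt_apply (f : PowerSeries K) (Q : Op K) (hQ : ∀ p, ∃ N : ℕ, (Q ^ N) p = 0)
    (p : K[X]) :
    seriesAt f Q p = ∑ᶠ k : ℕ, PowerSeries.coeff k f • (Q ^ k) p := by
  have fin : ∀ p : K[X],
      (Function.support fun k : ℕ => PowerSeries.coeff k f • (Q ^ k) p).Finite := by
    intro p
    obtain ⟨N, hN⟩ := hQ p
    refine (Set.finite_Iio N).subset fun k hk => ?_
    by_contra hlt
    apply hk
    obtain ⟨j, rfl⟩ := Nat.exists_eq_add_of_le (not_lt.mp hlt)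
    simp [add_comm N j, pow_add, hN]
  induction p using Polynomial.induction_on' with
  | add p q hp hq =>
    rw [map_add, hp, hq, ← finsum_add_distrib (fin p) (fin q)]
    simp
  | monomial n a =>
    rw [← mul_one a, ← smul_eq_mul, ← smul_monomial, Polynomial.monomial_one_right_eq_X_pow,
      map_smul, seriesAt_X_pow, smul_finsum' _ (fin _)]
    refine finsum_congr fun k => ?_
    rw [map_smul, smul_comm]

open Classical in
/-- The indicator of a shift-invariant operator `T`: the power series `T̃` with `T̃(D) = T`. -/
def indicator (T : Op K) : PowerSeries K :=
  if h : ∃ f : PowerSeries K, seriesAt f D = T then h.choose else 0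

open Classical in
/-- The compositional inverse of a power series of order one. -/
def compInverse (f : PowerSeries K) : PowerSeries K :=
  if h : IsUnit (PowerSeries.coeff 1 f) then f.substInvOfIsUnit h else 0

/-- The partial Bell polynomial `B_{n,k}` in the variables `x_1, x_2, …`, defined by
`(∑_{j ≥ 1} x_j t^j / j!)^k / k! = ∑ₙ B_{n,k} t^n / n!`. (The variable `x_0` is not used.) -/
def bell (K : Type*) [Field K] (n k : ℕ) : MvPolynomial ℕ K :=
  MvPolynomial.C ((n.factorial : K) / (k.factorial : K)) *
    PowerSeries.coeff n
      ((PowerSeries.mk fun j : ℕ =>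
        if j = 0 then 0
        else MvPolynomial.C ((j.factorial : K)⁻¹) * MvPolynomial.X j :
          PowerSeries (MvPolynomial ℕ K)) ^ k)

/-- The value of a polynomial at a family of operators: every monomial `∏ⱼ x_j ^ m_j` becomes
the product of the `a_j ^ m_j`, taken in increasing order of `j`. It is meant for operators that
commute with one another, so that the order does not matter. -/
def evalAt (a : ℕ → Op K) (p : MvPolynomial ℕ K) : Op K :=
  ∑ m ∈ p.support, p.coeff m • ((m.support.sort (· ≤ ·)).map fun j => a j ^ m j).prod

end

end Umbral

/-! Let g be the compositional inverse of the indicator of Q, so that D = g(Q). The Pincherle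
derivative is a derivation with D' = 1, so the chain rule `IsLocallyNilpotent.pincherle_seriesAt`
gives g'(Q) Q' = 1: Q' is invertible with inverse g'(Q).

Put M = x (Q')⁻¹. Then QM - MQ = Q' (Q')⁻¹ = 1, and every Mp vanishes at 0. Since the kernel of Q
consists of constants, induction on n gives φ x^{n+1} = M φ x^n, that is φ x = M φ
(`IsUmbral.mul_mulX`); powers follow.

To expand M^n = (x g'(Q))^n, move series in Q to the right: b(Q) M = x (b g')(Q) + b'(Q). The
coefficients b_{n,k} of x^k thus satisfy b_{n+1,k+1} = b_{n,k+1}' + b_{n,k} g', which is the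
recurrence of the Bell polynomials in g', g'', … (`aeval_bell_succ_succ`). The Bell polynomials are
computed in the commutative ring K[[t]] and transported to operators by t ↦ Q. -/

namespace Umbral

open Polynomial

/-- Every polynomial is killed by a power of `Q`. -/
def IsLocallyNilpotent {K : Type*} [Field K] (Q : Op K) : Prop := ∀ p, ∃ N : ℕ, (Q ^ N) p = 0

/-! ### Functional calculus f ↦ f(Q) for locally nilpotent Q. -/

section Series

variable {K : Type*} [Field K] {Q : Op K}

theorem pow_apply_eq_zero_of_le {N M : ℕ} {p : K[X]} (hN : (Q ^ N) p = 0) (h : N ≤ M) :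
    (Q ^ M) p = 0 := by
  obtain ⟨j, rfl⟩ := Nat.exists_eq_add_of_le h
  rw [add_comm, pow_add, Module.End.mul_apply, hN, map_zero]

theorem Commute.apply_eq_zero {A B : Op K} (h : Commute A B) {p : K[X]} (hp : A p = 0) :
    A (B p) = 0 := by
  rw [← Module.End.mul_apply, h.eq, Module.End.mul_apply, hp, map_zero]

/-- Powers of Q from N on kill p, so only f modulo t^N matters. This reduces identities between
series in Q to polynomial ones, vector by vector. -/
theorem IsLocallyNilpotent.seriesAt_apply_eq_aeval (hQ : IsLocallyNilpotent Q)
    (f : PowerSeries K) (P : K[X]) {N : ℕ} {p : K[X]} (hN : (Q ^ N) p = 0)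
    (hP : ∀ k < N, PowerSeries.coeff k f = P.coeff k) :
    seriesAt f Q p = aeval Q P p := by
  rw [seriesAt_apply f Q hQ p, aeval_eq_sum_range' (n := max N (P.natDegree + 1)) (by omega),
    LinearMap.sum_apply, finsum_eq_sum_of_support_subset (s := Finset.range _)]
  · refine Finset.sum_congr rfl fun k _ => ?_
    rw [LinearMap.smul_apply]
    rcases lt_or_ge k N with hk | hk
    · rw [hP k hk]
    · rw [pow_apply_eq_zero_of_le hN hk, smul_zero, smul_zero]
  · intro k hk
    rw [Finset.coe_range, Set.mem_Iio, lt_max_iff]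
    by_contra hlt
    push Not at hlt
    exact hk (by simp only [pow_apply_eq_zero_of_le hN hlt.1, smul_zero])

theorem IsLocallyNilpotent.seriesAt_apply_eq_aeval_trunc (hQ : IsLocallyNilpotent Q)
    (f : PowerSeries K) {N : ℕ} {p : K[X]} (hN : (Q ^ N) p = 0) :
    seriesAt f Q p = aeval Q (PowerSeries.trunc N f) p :=
  hQ.seriesAt_apply_eq_aeval f _ hN fun k hk => by simp [PowerSeries.coeff_trunc, hk]

theorem aeval_commute {B : Op K} (h : Commute Q B) (P : K[X]) : Commute (aeval Q P) B := by
  induction P using Polynomial.induction_on' with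
  | add p q hp hq => rw [map_add]; exact hp.add_left hq
  | monomial n a =>
    rw [aeval_monomial]
    exact (Algebra.commute_algebraMap_left a B).mul_left (h.pow_left n)

theorem IsLocallyNilpotent.seriesAt_coe (hQ : IsLocallyNilpotent Q) (P : K[X]) :
    seriesAt (P : PowerSeries K) Q = aeval Q P := by
  refine LinearMap.ext fun p => ?_
  obtain ⟨N, hN⟩ := hQ p
  exact hQ.seriesAt_apply_eq_aeval _ _ hN fun k _ => by simp

theorem IsLocallyNilpotent.seriesAt_mul (hQ : IsLocallyNilpotent Q) (f g : PowerSeries K) :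
    seriesAt (f * g) Q = seriesAt f Q * seriesAt g Q := by
  refine LinearMap.ext fun p => ?_
  obtain ⟨N, hN⟩ := hQ p
  have hN' : (Q ^ N) (aeval Q (PowerSeries.trunc N g) p) = 0 :=
    Commute.apply_eq_zero (((aeval_commute (Commute.refl Q) _).pow_right N).symm) hN
  rw [Module.End.mul_apply, hQ.seriesAt_apply_eq_aeval_trunc g hN,
    hQ.seriesAt_apply_eq_aeval_trunc f hN', ← Module.End.mul_apply, ← map_mul]
  refine hQ.seriesAt_apply_eq_aeval _ _ hN fun k hk => ?_
  rw [PowerSeries.coeff_mul_eq_coeff_trunc_mul_trunc f g hk]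
  simp [← Polynomial.coeff_coe, ← Polynomial.coe_mul]

/-- `f ↦ f(Q)` as an algebra homomorphism. -/
noncomputable def IsLocallyNilpotent.seriesHom (hQ : IsLocallyNilpotent Q) :
    PowerSeries K →ₐ[K] Op K where
  toFun f := seriesAt f Q
  map_one' := by simpa using hQ.seriesAt_coe 1
  map_mul' := hQ.seriesAt_mul
  map_zero' := by simpa using hQ.seriesAt_coe 0
  map_add' f g := by
    refine LinearMap.ext fun p => ?_
    obtain ⟨N, hN⟩ := hQ p
    simp [hQ.seriesAt_apply_eq_aeval_trunc _ hN]
  commutes' a := by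
    have h := hQ.seriesAt_coe (C a)
    rw [aeval_C, Polynomial.coe_C] at h
    exact h

theorem IsLocallyNilpotent.seriesHom_apply (hQ : IsLocallyNilpotent Q) (f : PowerSeries K) :
    hQ.seriesHom f = seriesAt f Q := rfl

theorem IsLocallyNilpotent.seriesHom_X (hQ : IsLocallyNilpotent Q) :
    hQ.seriesHom PowerSeries.X = Q := by
  simpa [seriesHom_apply] using hQ.seriesAt_coe X

theorem IsLocallyNilpotent.seriesAt_commute (hQ : IsLocallyNilpotent Q) {B : Op K}
    (h : Commute Q B) (f : PowerSeries K) : Commute (seriesAt f Q) B := by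
  refine LinearMap.ext fun p => ?_
  obtain ⟨N, hN⟩ := hQ p
  have hN' : (Q ^ N) (B p) = 0 := Commute.apply_eq_zero (h.pow_left N) hN
  rw [Module.End.mul_apply, Module.End.mul_apply, hQ.seriesAt_apply_eq_aeval_trunc f hN,
    hQ.seriesAt_apply_eq_aeval_trunc f hN', ← Module.End.mul_apply, (aeval_commute h _).eq,
    Module.End.mul_apply]

theorem coeff_pow_eq_zero_of_lt {R : Type*} [CommRing R] {q : PowerSeries R}
    (hq : PowerSeries.constantCoeff q = 0) {n k : ℕ} (h : n < k) :
    PowerSeries.coeff n (q ^ k) = 0 :=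
  PowerSeries.X_pow_dvd_iff.1 (pow_dvd_pow_of_dvd (PowerSeries.X_dvd_iff.2 hq) k) n h

theorem IsLocallyNilpotent.seriesAt_pow_apply_eq_zero (hQ : IsLocallyNilpotent Q)
    {q : PowerSeries K} (hq : PowerSeries.constantCoeff q = 0) {N : ℕ} {p : K[X]}
    (hN : (Q ^ N) p = 0) : (seriesAt q Q ^ N) p = 0 := by
  obtain ⟨r, rfl⟩ := PowerSeries.X_dvd_iff.2 hq
  rw [← hQ.seriesHom_apply, ← map_pow, mul_pow, mul_comm, map_mul,
    map_pow hQ.seriesHom PowerSeries.X, hQ.seriesHom_X, Module.End.mul_apply, hN, map_zero]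

theorem IsLocallyNilpotent.seriesAt_of_constantCoeff_eq_zero (hQ : IsLocallyNilpotent Q)
    {q : PowerSeries K} (hq : PowerSeries.constantCoeff q = 0) :
    IsLocallyNilpotent (seriesAt q Q) := fun p =>
  (hQ p).imp fun _ hN => hQ.seriesAt_pow_apply_eq_zero hq hN

/-- `g(q(Q)) = (g ∘ q)(Q)`. -/
theorem IsLocallyNilpotent.seriesAt_seriesAt (hQ : IsLocallyNilpotent Q)
    {q : PowerSeries K} (hq : PowerSeries.constantCoeff q = 0) (g : PowerSeries K) :
    seriesAt g (seriesAt q Q) = seriesAt (g.subst q) Q := by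
  refine LinearMap.ext fun p => ?_
  obtain ⟨N, hN⟩ := hQ p
  rw [(hQ.seriesAt_of_constantCoeff_eq_zero hq).seriesAt_apply_eq_aeval_trunc g
      (hQ.seriesAt_pow_apply_eq_zero hq hN),
    ← hQ.seriesHom_apply, aeval_algHom_apply, hQ.seriesHom_apply,
    hQ.seriesAt_apply_eq_aeval_trunc _ hN, hQ.seriesAt_apply_eq_aeval_trunc _ hN]
  -- It remains to compare coefficients below N; there q^j contributes only for j < N, its order
  -- being at least j.
  congr 2
  ext k
  rw [PowerSeries.coeff_trunc, PowerSeries.coeff_trunc]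
  split_ifs with hk
  · rw [PowerSeries.coeff_subst' (PowerSeries.HasSubst.of_constantCoeff_zero' hq),
      finsum_eq_sum_of_support_subset (s := Finset.range N), aeval_def,
      PowerSeries.eval₂_trunc_eq_sum_range, map_sum]
    · refine Finset.sum_congr rfl fun j _ => ?_
      rw [← Algebra.smul_def, map_smul]
    · intro j hj
      rw [Finset.coe_range, Set.mem_Iio]
      by_contra hlt
      exact hj (by simp only [coeff_pow_eq_zero_of_lt hq (hk.trans_le (not_lt.1 hlt)), smul_zero])
  · rfl

end Series

/-! ### The Pincherle derivative as a derivation, and its chain rule. -/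

section Pincherle

variable {K : Type*} [Field K] {Q : Op K}

theorem pincherle_mul (A B : Op K) :
    pincherle (A * B) = A * pincherle B + pincherle A * B := by
  simp only [pincherle, mul_sub, sub_mul, mul_assoc, sub_add_sub_cancel]

theorem pincherle_add (A B : Op K) : pincherle (A + B) = pincherle A + pincherle B := by
  simp only [pincherle]; noncomm_ring

theorem pincherle_algebraMap_mul (a : K) (A : Op K) :
    pincherle (algebraMap K (Op K) a * A) = algebraMap K (Op K) a * pincherle A := by
  rw [pincherle_mul, add_eq_left, pincherle, Algebra.commutes a mulX, sub_self, zero_mul]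

theorem pincherle_pow (h : Commute Q (pincherle Q)) (n : ℕ) :
    pincherle (Q ^ n) = n * Q ^ (n - 1) * pincherle Q := by
  induction n with
  | zero => simp [pincherle]
  | succ n ih =>
    rw [pow_succ, pincherle_mul, ih, mul_assoc, ← h.eq, ← mul_assoc]
    rcases n with _ | n
    · simp
    · simp only [Nat.add_sub_cancel, pow_succ]
      push_cast
      noncomm_ring

theorem pincherle_aeval (h : Commute Q (pincherle Q)) (P : K[X]) :
    pincherle (aeval Q P) = aeval Q (derivative P) * pincherle Q := by
  induction P using Polynomial.induction_on' with
  | add p q hp hq => simp only [map_add, pincherle_add, hp, hq, add_mul]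
  | monomial n a =>
    rw [aeval_monomial, pincherle_algebraMap_mul, pincherle_pow h, derivative_monomial,
      aeval_monomial, map_mul, map_natCast]
    simp only [mul_assoc]

theorem IsLocallyNilpotent.pincherle_seriesAt (hQ : IsLocallyNilpotent Q)
    (h : Commute Q (pincherle Q)) (f : PowerSeries K) :
    pincherle (seriesAt f Q) = seriesAt (PowerSeries.derivative K f) Q * pincherle Q := by
  refine LinearMap.ext fun p => ?_
  obtain ⟨N, hN⟩ := hQ p
  obtain ⟨M, hM⟩ := hQ (mulX p)
  -- L must serve both p and xp, since T' evaluates T at each. The truncation is taken one longer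
  -- because differentiating it loses a term.
  set L := max N M
  have hN' : (Q ^ L) p = 0 := pow_apply_eq_zero_of_le hN (le_max_left _ _)
  have e : pincherle (seriesAt f Q) p = pincherle (aeval Q (PowerSeries.trunc (L + 1) f)) p := by
    simp only [pincherle, LinearMap.sub_apply, Module.End.mul_apply]
    rw [hQ.seriesAt_apply_eq_aeval_trunc f
        (pow_apply_eq_zero_of_le hN ((le_max_left N M).trans (Nat.le_succ _))),
      hQ.seriesAt_apply_eq_aeval_trunc f
        (pow_apply_eq_zero_of_le hM ((le_max_right N M).trans (Nat.le_succ _)))]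
  rw [e, pincherle_aeval h, ← PowerSeries.trunc_derivative, Module.End.mul_apply,
    Module.End.mul_apply,
    hQ.seriesAt_apply_eq_aeval_trunc _ (Commute.apply_eq_zero (h.pow_left L) hN')]

end Pincherle

/-! ### Delta operators as series in D, and the raising operator x (Q')⁻¹. -/

section Delta

variable {K : Type*} [Field K]

theorem D_pow_apply (k : ℕ) (p : K[X]) : ((D : Op K) ^ k) p = derivative^[k] p := by
  rw [Module.End.pow_apply]; rfl

theorem isLocallyNilpotent_D : IsLocallyNilpotent (D : Op K) := fun p =>
  ⟨p.natDegree + 1, by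
    rw [D_pow_apply, iterate_derivative_eq_zero (Nat.lt_succ_self _)]⟩

theorem pincherle_D : pincherle (D : Op K) = 1 := by
  refine LinearMap.ext fun p => ?_
  simp [pincherle, D, mulX]

theorem D_mul_shift (a : K) : D * shift a = shift a * D := by
  refine LinearMap.ext fun p => ?_
  simp [D, shift, taylor_apply, derivative_comp]

theorem eval_zero_seriesAt_D_X_pow (f : PowerSeries K) (n : ℕ) :
    (seriesAt f D (X ^ n)).eval 0 = (n.factorial : K) * PowerSeries.coeff n f := by
  have h : ((D : Op K) ^ (n + 1)) (X ^ n) = 0 := by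
    rw [D_pow_apply, iterate_derivative_eq_zero (by simp)]
  rw [isLocallyNilpotent_D.seriesAt_apply_eq_aeval_trunc f h, aeval_def,
    PowerSeries.eval₂_trunc_eq_sum_range, LinearMap.sum_apply, eval_finsetSum,
    Finset.sum_range_succ, Finset.sum_eq_zero, zero_add]
  · rw [← Algebra.smul_def, LinearMap.smul_apply, eval_smul, D_pow_apply,
      iterate_derivative_X_pow_eq_smul]
    simp [Nat.descFactorial_self, mul_comm]
  · intro k hk
    rw [← Algebra.smul_def, LinearMap.smul_apply, eval_smul, D_pow_apply,
      iterate_derivative_X_pow_eq_smul]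
    have : n - k ≠ 0 := by have := Finset.mem_range.1 hk; omega
    simp [this]

theorem seriesAt_D_X (f : PowerSeries K) :
    seriesAt f D X = PowerSeries.coeff 0 f • X + C (PowerSeries.coeff 1 f) := by
  have h : ((D : Op K) ^ 2) X = 0 := by
    rw [D_pow_apply, iterate_derivative_eq_zero (by simp)]
  rw [isLocallyNilpotent_D.seriesAt_apply_eq_aeval_trunc f h, aeval_def,
    PowerSeries.eval₂_trunc_eq_sum_range, LinearMap.sum_apply, Finset.sum_range_succ,
    Finset.sum_range_one]
  simp [← Algebra.smul_def, D, smul_eq_C_mul]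

/-- The expansion theorem: shift-invariant operators are power series in the derivative. -/
theorem IsShiftInvariant.exists_seriesAt_D [CharZero K] {T : Op K} (hT : IsShiftInvariant T) :
    ∃ f : PowerSeries K, seriesAt f D = T := by
  -- These coefficients are forced, as f(D) x^n has value n! f_n at 0.
  set f : PowerSeries K := PowerSeries.mk fun n => (T (X ^ n)).eval 0 / (n.factorial : K)
  have h0 : ∀ p, (seriesAt f D p).eval 0 = (T p).eval 0 := by
    intro p
    induction p using Polynomial.induction_on' with
    | add p q hp hq => simp only [map_add, eval_add, hp, hq]
    | monomial n a =>
      have hn : (n.factorial : K) ≠ 0 := Nat.cast_ne_zero.2 n.factorial_ne_zero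
      rw [← mul_one a, ← smul_eq_mul, ← smul_monomial, monomial_one_right_eq_X_pow, map_smul,
        map_smul, eval_smul, eval_smul, eval_zero_seriesAt_D_X_pow, PowerSeries.coeff_mk,
        mul_div_cancel₀ _ hn]
  refine ⟨f, LinearMap.ext fun p => Polynomial.funext fun a => ?_⟩
  -- A shift-invariant operator is determined by the functional p ↦ (Up)(0).
  have key : ∀ U : Op K, U * shift a = shift a * U →
      (U p).eval a = (U (shift a p)).eval 0 := by
    intro U hU
    rw [← Module.End.mul_apply, hU, Module.End.mul_apply, shift, taylor_eval, zero_add]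
  rw [key _ (isLocallyNilpotent_D.seriesAt_commute (D_mul_shift a) f).eq, key T (hT a), h0]

theorem IsShiftInvariant.seriesAt_indicator [CharZero K] {T : Op K} (hT : IsShiftInvariant T) :
    seriesAt (indicator T) D = T := by
  rw [indicator, dif_pos hT.exists_seriesAt_D]
  exact hT.exists_seriesAt_D.choose_spec

variable [CharZero K] {Q : Op K}

theorem IsDelta.seriesAt_indicator (hQ : IsDelta Q) : seriesAt (indicator Q) D = Q :=
  hQ.shiftInvariant.seriesAt_indicator

theorem IsDelta.constantCoeff_indicator (hQ : IsDelta Q) :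
    PowerSeries.constantCoeff (indicator Q) = 0 := by
  obtain ⟨c, -, h⟩ := hQ.map_X
  rw [← hQ.seriesAt_indicator, seriesAt_D_X] at h
  simpa [coeff_C] using congrArg (fun p => coeff p 1) h

theorem IsDelta.isUnit_coeff_one_indicator (hQ : IsDelta Q) :
    IsUnit (PowerSeries.coeff 1 (indicator Q)) := by
  obtain ⟨c, hc, h⟩ := hQ.map_X
  rw [← hQ.seriesAt_indicator, seriesAt_D_X] at h
  have : PowerSeries.coeff 1 (indicator Q) = c := by
    simpa using congrArg (fun p => coeff p 0) h
  exact this ▸ hc.isUnit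

theorem IsDelta.compInverse_indicator (hQ : IsDelta Q) : compInverse (indicator Q) =
    (indicator Q).substInvOfIsUnit hQ.isUnit_coeff_one_indicator :=
  dif_pos _

theorem IsDelta.indicator_subst_compInverse (hQ : IsDelta Q) :
    (indicator Q).subst (compInverse (indicator Q)) = PowerSeries.X := by
  rw [hQ.compInverse_indicator]
  exact PowerSeries.subst_substInvOfIsUnit_right _ hQ.constantCoeff_indicator _

theorem IsDelta.compInverse_subst_indicator (hQ : IsDelta Q) :
    (compInverse (indicator Q)).subst (indicator Q) = PowerSeries.X := by
  rw [hQ.compInverse_indicator]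
  exact PowerSeries.subst_substInvOfIsUnit_left _ hQ.constantCoeff_indicator _

theorem IsDelta.isLocallyNilpotent (hQ : IsDelta Q) : IsLocallyNilpotent Q := by
  rw [← hQ.seriesAt_indicator]
  exact isLocallyNilpotent_D.seriesAt_of_constantCoeff_eq_zero hQ.constantCoeff_indicator

theorem IsDelta.seriesAt_compInverse (hQ : IsDelta Q) :
    seriesAt (compInverse (indicator Q)) Q = D := by
  have h := isLocallyNilpotent_D.seriesAt_seriesAt hQ.constantCoeff_indicator
    (compInverse (indicator Q))
  rw [hQ.seriesAt_indicator, hQ.compInverse_subst_indicator] at h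
  exact h.trans isLocallyNilpotent_D.seriesHom_X

theorem IsDelta.pincherle_eq (hQ : IsDelta Q) :
    pincherle Q = seriesAt (PowerSeries.derivative K (indicator Q)) D := by
  have h := isLocallyNilpotent_D.pincherle_seriesAt
    (pincherle_D (K := K) ▸ Commute.one_right D) (indicator Q)
  rwa [hQ.seriesAt_indicator, pincherle_D, mul_one] at h

theorem IsDelta.commute_pincherle (hQ : IsDelta Q) : Commute Q (pincherle Q) := by
  have h : Commute (seriesAt (indicator Q) D) (pincherle Q) := by
    rw [hQ.pincherle_eq]
    exact isLocallyNilpotent_D.seriesAt_commute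
      (isLocallyNilpotent_D.seriesAt_commute (Commute.refl D) _).symm _
  rwa [hQ.seriesAt_indicator] at h

/-- The chain rule applied to g(Q) = D, together with D' = 1. -/
theorem IsDelta.seriesAt_derivative_mul_pincherle (hQ : IsDelta Q) :
    seriesAt (PowerSeries.derivative K (compInverse (indicator Q))) Q * pincherle Q = 1 := by
  rw [← hQ.isLocallyNilpotent.pincherle_seriesAt hQ.commute_pincherle, hQ.seriesAt_compInverse,
    pincherle_D]

theorem IsDelta.pincherle_mul_seriesAt_derivative (hQ : IsDelta Q) :
    pincherle Q * seriesAt (PowerSeries.derivative K (compInverse (indicator Q))) Q = 1 := by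
  rw [← (hQ.isLocallyNilpotent.seriesAt_commute hQ.commute_pincherle _).eq,
    hQ.seriesAt_derivative_mul_pincherle]

theorem IsDelta.isUnit_pincherle (hQ : IsDelta Q) : IsUnit (pincherle Q) :=
  ⟨⟨_, _, hQ.pincherle_mul_seriesAt_derivative, hQ.seriesAt_derivative_mul_pincherle⟩, rfl⟩

theorem IsDelta.inverse_pincherle (hQ : IsDelta Q) : Ring.inverse (pincherle Q) =
    seriesAt (PowerSeries.derivative K (compInverse (indicator Q))) Q :=
  Ring.inverse_unit ⟨_, _, hQ.pincherle_mul_seriesAt_derivative,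
    hQ.seriesAt_derivative_mul_pincherle⟩

/-- The kernel of a delta operator consists of constants. -/
theorem IsDelta.eq_zero_of_apply_eq_zero (hQ : IsDelta Q) {p : K[X]} (hp : Q p = 0)
    (h0 : p.eval 0 = 0) : p = 0 := by
  -- The inverse series is t r, so D = r(Q) Q and Qp = 0 forces Dp = 0.
  obtain ⟨r, hr⟩ := PowerSeries.X_dvd_iff.2 (show PowerSeries.constantCoeff
    (compInverse (indicator Q)) = 0 by rw [hQ.compInverse_indicator]; simp)
  have hD : derivative p = 0 := by
    change D p = 0
    rw [← hQ.seriesAt_compInverse, hr, mul_comm, ← hQ.isLocallyNilpotent.seriesHom_apply, map_mul,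
      hQ.isLocallyNilpotent.seriesHom_X, Module.End.mul_apply, hp, map_zero]
  rw [eq_C_of_natDegree_eq_zero (derivative_eq_zero.1 hD),
    coeff_zero_eq_eval_zero, h0, C_0]

theorem IsDelta.apply_raising (hQ : IsDelta Q) (p : K[X]) :
    Q ((mulX * Ring.inverse (pincherle Q) : Op K) p) =
      (mulX * Ring.inverse (pincherle Q) : Op K) (Q p) + p := by
  have h : Q * (mulX * Ring.inverse (pincherle Q)) =
      mulX * Ring.inverse (pincherle Q) * Q + 1 := by
    have hc : Commute Q (Ring.inverse (pincherle Q)) := by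
      rw [hQ.inverse_pincherle]
      exact (hQ.isLocallyNilpotent.seriesAt_commute (Commute.refl Q) _).symm
    rw [mul_assoc mulX, ← hc.eq, ← mul_assoc, ← mul_assoc, ← sub_eq_iff_eq_add', ← sub_mul,
      ← pincherle, Ring.mul_inverse_cancel _ hQ.isUnit_pincherle]
  exact LinearMap.congr_fun h p

/-- On each x^n both sides vanish at 0 and have the same image under Q, by induction and QM = MQ +
1; hence they agree. -/
theorem IsUmbral.mul_mulX {φ : Op K} (h : IsUmbral φ Q) :
    φ * mulX = mulX * Ring.inverse (pincherle Q) * φ := by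
  set M : Op K := mulX * Ring.inverse (pincherle Q) with hM
  have hQM : ∀ p, Q (M p) = M (Q p) + p := h.delta.apply_raising
  have eval_M : ∀ p, (M p).eval 0 = 0 := fun p => by simp [hM, mulX]
  have key : ∀ n : ℕ, φ (X ^ (n + 1)) = M (φ (X ^ n)) := by
    intro n
    induction n with
    | zero =>
      rw [← sub_eq_zero]
      refine h.delta.eq_zero_of_apply_eq_zero ?_ ?_
      · rw [map_sub, hQM, h.sheffer.map_seq, h.sheffer.map_seq]
        simp
      · rw [eval_sub, h.eval_zero _ Nat.one_pos, eval_M, sub_zero]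
    | succ n ih =>
      rw [← sub_eq_zero]
      refine h.delta.eq_zero_of_apply_eq_zero ?_ ?_
      · rw [map_sub, hQM, h.sheffer.map_seq, h.sheffer.map_seq, map_smul, Nat.add_sub_cancel,
          Nat.add_sub_cancel, ← ih]
        push_cast
        module
      · rw [eval_sub, h.eval_zero _ (Nat.succ_pos _), eval_M, sub_zero]
  refine Polynomial.lhom_ext' fun n => LinearMap.ext_ring ?_
  have hx : mulX (X ^ n : K[X]) = X ^ (n + 1) := by rw [pow_succ']; rfl
  change φ (mulX (monomial n 1)) = M (φ (monomial n 1))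
  rw [monomial_one_right_eq_X_pow, hx, key]

end Delta

/-! ### Bell polynomials at the iterated derivatives of an element. -/

section Bell

variable {K R : Type*} [Field K] [CommRing R] [Algebra K R]

/-- The exponential generating series `∑_{j ≥ 1} d^j(g) u^j / j!` of the derivatives of `g`. -/
noncomputable def derivSeries (d : Derivation K R R) (g : R) : PowerSeries R :=
  PowerSeries.mk fun j : ℕ => if j = 0 then 0 else ((j.factorial : K)⁻¹) • d^[j] g

theorem constantCoeff_derivSeries (d : Derivation K R R) (g : R) :
    PowerSeries.constantCoeff (derivSeries d g) = 0 := by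
  simp [derivSeries, ← PowerSeries.coeff_zero_eq_constantCoeff_apply]

/-- A derivation of the coefficients, applied coefficientwise. -/
noncomputable def coeffwise (d : Derivation K R R) (F : PowerSeries R) : PowerSeries R :=
  PowerSeries.mk fun n => d (PowerSeries.coeff n F)

theorem coeffwise_mul (d : Derivation K R R) (F G : PowerSeries R) :
    coeffwise d (F * G) = F * coeffwise d G + coeffwise d F * G := by
  ext n
  simp only [coeffwise, PowerSeries.coeff_mk, PowerSeries.coeff_mul, map_add, map_sum,
    Derivation.leibniz, smul_eq_mul, Finset.sum_add_distrib]
  simp only [mul_comm]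

theorem coeffwise_pow (d : Derivation K R R) (F : PowerSeries R) (k : ℕ) :
    coeffwise d (F ^ k) = k * F ^ (k - 1) * coeffwise d F := by
  induction k with
  | zero =>
    ext n
    rw [pow_zero, coeffwise, PowerSeries.coeff_mk, PowerSeries.coeff_one]
    split_ifs <;> simp
  | succ k ih =>
    rw [pow_succ, coeffwise_mul, ih]
    rcases k with _ | k
    · simp
    · simp only [Nat.add_sub_cancel, pow_succ]
      push_cast
      ring

/-- Differentiating in u shifts d^j g to d^{j+1} g, just as d does on coefficients; the constant d g
is the shifted j = 0 term, which the series omits. -/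
theorem derivative_derivSeries [CharZero K] (d : Derivation K R R) (g : R) :
    PowerSeries.derivative R (derivSeries d g) =
      coeffwise d (derivSeries d g) + PowerSeries.C (d g) := by
  ext n
  have e : (((n + 1).factorial : K)⁻¹) * ((n : K) + 1) = (n.factorial : K)⁻¹ := by
    have h1 : (n : K) + 1 ≠ 0 := Nat.cast_add_one_ne_zero n
    have h2 : (n.factorial : K) ≠ 0 := Nat.cast_ne_zero.2 n.factorial_ne_zero
    rw [Nat.factorial_succ]; push_cast; field_simp
  have hc : (n : R) + 1 = algebraMap K R ((n : K) + 1) := by simp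
  rw [PowerSeries.coeff_derivative, map_add, PowerSeries.coeff_C, derivSeries, coeffwise,
    PowerSeries.coeff_mk, PowerSeries.coeff_mk, PowerSeries.coeff_mk, if_neg n.succ_ne_zero,
    hc, mul_comm, ← Algebra.smul_def, smul_smul, mul_comm, e, Function.iterate_succ_apply']
  rcases n with _ | n
  · simp
  · simp

theorem coeff_succ_derivSeries_pow [CharZero K] (d : Derivation K R R) (g : R) (n k : ℕ) :
    PowerSeries.coeff (n + 1) (derivSeries d g ^ k) * (n + 1) =
      d (PowerSeries.coeff n (derivSeries d g ^ k)) +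
        k * PowerSeries.coeff n (derivSeries d g ^ (k - 1)) * d g := by
  have h : PowerSeries.derivative R (derivSeries d g ^ k) = coeffwise d (derivSeries d g ^ k) +
      PowerSeries.C (k : R) * derivSeries d g ^ (k - 1) * PowerSeries.C (d g) := by
    rw [PowerSeries.derivative_pow, derivative_derivSeries, coeffwise_pow, map_natCast]
    ring
  have h' := congrArg (PowerSeries.coeff n) h
  rw [PowerSeries.coeff_derivative, map_add, PowerSeries.coeff_mul_C, PowerSeries.coeff_C_mul] at h'
  rw [h', coeffwise, PowerSeries.coeff_mk]

theorem aeval_bell (d : Derivation K R R) (g : R) (n k : ℕ) :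
    MvPolynomial.aeval (fun j => d^[j] g) (bell K n k) =
      ((n.factorial : K) / (k.factorial : K)) • PowerSeries.coeff n (derivSeries d g ^ k) := by
  have h : PowerSeries.map (MvPolynomial.aeval (R := K) fun j => d^[j] g).toRingHom
      (PowerSeries.mk fun j : ℕ => if j = 0 then 0
        else MvPolynomial.C ((j.factorial : K)⁻¹) * MvPolynomial.X j) = derivSeries d g := by
    ext j
    rw [PowerSeries.coeff_map, PowerSeries.coeff_mk, derivSeries, PowerSeries.coeff_mk]
    split_ifs
    · simp
    · simp [Algebra.smul_def]
  rw [← h, ← map_pow, PowerSeries.coeff_map, bell, map_mul, MvPolynomial.aeval_C, Algebra.smul_def]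
  rfl

theorem aeval_bell_eq_zero_of_lt (d : Derivation K R R) (g : R) {n k : ℕ} (h : n < k) :
    MvPolynomial.aeval (fun j => d^[j] g) (bell K n k) = 0 := by
  rw [aeval_bell, coeff_pow_eq_zero_of_lt (constantCoeff_derivSeries d g) h, smul_zero]

theorem aeval_bell_zero_zero (d : Derivation K R R) (g : R) :
    MvPolynomial.aeval (fun j => d^[j] g) (bell K 0 0) = 1 := by
  rw [aeval_bell]; simp

theorem aeval_bell_succ_zero [CharZero K] (d : Derivation K R R) (g : R) (n : ℕ) :
    MvPolynomial.aeval (fun j => d^[j] g) (bell K (n + 1) 0) =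
      d (MvPolynomial.aeval (fun j => d^[j] g) (bell K n 0)) := by
  rw [aeval_bell, aeval_bell, pow_zero, PowerSeries.coeff_one, PowerSeries.coeff_one,
    if_neg n.succ_ne_zero, d.map_smul]
  split_ifs <;> simp

/-- The u^n coefficient of the u-derivative of the (k+1)-st power of the generating series, rescaled
by factorials. -/
theorem aeval_bell_succ_succ [CharZero K] (d : Derivation K R R) (g : R) (n k : ℕ) :
    MvPolynomial.aeval (fun j => d^[j] g) (bell K (n + 1) (k + 1)) =
      d (MvPolynomial.aeval (fun j => d^[j] g) (bell K n (k + 1))) +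
        MvPolynomial.aeval (fun j => d^[j] g) (bell K n k) * d g := by
  have h := coeff_succ_derivSeries_pow d g n (k + 1)
  have hk : (k.factorial : K) ≠ 0 := Nat.cast_ne_zero.2 k.factorial_ne_zero
  have hk' : (k : K) + 1 ≠ 0 := Nat.cast_add_one_ne_zero k
  rw [Nat.add_sub_cancel] at h
  rw [aeval_bell, aeval_bell, aeval_bell, d.map_smul]
  have e1 : ((n + 1).factorial : K) / ((k + 1).factorial : K) =
      (n.factorial : K) / ((k + 1).factorial : K) * ((n : K) + 1) := by
    rw [Nat.factorial_succ n]; push_cast; ring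
  have e2 : (n.factorial : K) / (k.factorial : K) =
      (n.factorial : K) / ((k + 1).factorial : K) * ((k : K) + 1) := by
    rw [Nat.factorial_succ k]; push_cast; field_simp
  rw [e1, e2, mul_smul, mul_smul, smul_mul_assoc, ← smul_add]
  congr 1
  rw [Algebra.smul_def, Algebra.smul_def, map_add, map_add, map_natCast, map_natCast, map_one,
    mul_comm, h]
  push_cast
  ring

end Bell

/-! ### Evaluating polynomials at commuting operators. -/

section EvalAt

variable {K : Type*} [Field K]

/-- Evaluation at operators in the image of a commutative algebra is evaluation there. -/
theorem evalAt_algHom {R : Type*} [CommRing R] [Algebra K R] (S : R →ₐ[K] Op K) (a : ℕ → R)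
    (p : MvPolynomial ℕ K) :
    evalAt (fun j => S (a j)) p = S (MvPolynomial.aeval a p) := by
  rw [evalAt, MvPolynomial.aeval_def, MvPolynomial.eval₂_eq, map_sum]
  refine Finset.sum_congr rfl fun m _ => ?_
  rw [← Algebra.smul_def, map_smul]
  congr 1
  have h : ∏ j ∈ m.support, a j ^ m j = ((m.support.sort (· ≤ ·)).map fun j => a j ^ m j).prod := by
    rw [← Multiset.prod_coe, ← Multiset.map_coe, Finset.sort_eq]
    rfl
  rw [h, map_list_prod, List.map_map]
  simp [Function.comp_def]

end EvalAt

/-! ### Normal ordering of the powers of the raising operator. -/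

section Rodrigues

variable {K : Type*} [Field K] [CharZero K] {Q : Op K}

/-- From b(Q) x = x b(Q) + b'(Q) Q', the last factor being cancelled by g'(Q). -/
theorem IsDelta.seriesAt_mul_mulX_mul_derivative (hQ : IsDelta Q) (b : PowerSeries K) :
    hQ.isLocallyNilpotent.seriesHom b * (mulX * hQ.isLocallyNilpotent.seriesHom
        (PowerSeries.derivative K (compInverse (indicator Q)))) =
      mulX * hQ.isLocallyNilpotent.seriesHom
          (b * PowerSeries.derivative K (compInverse (indicator Q))) +
        hQ.isLocallyNilpotent.seriesHom (PowerSeries.derivative K b) := by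
  have h := hQ.isLocallyNilpotent.pincherle_seriesAt hQ.commute_pincherle b
  rw [pincherle, sub_eq_iff_eq_add'] at h
  rw [hQ.isLocallyNilpotent.seriesHom_apply b, ← mul_assoc, h, add_mul, mul_assoc, mul_assoc,
    hQ.isLocallyNilpotent.seriesHom_apply, hQ.pincherle_mul_seriesAt_derivative, mul_one,
    hQ.isLocallyNilpotent.seriesHom_apply, hQ.isLocallyNilpotent.seriesHom_apply,
    hQ.isLocallyNilpotent.seriesAt_mul]

theorem IsDelta.raising_pow (hQ : IsDelta Q) (n : ℕ) :
    (mulX * Ring.inverse (pincherle Q)) ^ n =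
      ∑ k ∈ Finset.range (n + 1), mulX ^ k * hQ.isLocallyNilpotent.seriesHom
        (MvPolynomial.aeval
          (fun j => (PowerSeries.derivative K)^[j] (compInverse (indicator Q))) (bell K n k)) := by
  rw [hQ.inverse_pincherle, ← hQ.isLocallyNilpotent.seriesHom_apply]
  set g := compInverse (indicator Q)
  set S := hQ.isLocallyNilpotent.seriesHom
  set d := PowerSeries.derivative K
  set b : ℕ → ℕ → PowerSeries K := fun n k =>
    MvPolynomial.aeval (fun j => d^[j] g) (bell K n k) with hb
  change _ = ∑ k ∈ Finset.range (n + 1), mulX ^ k * S (b n k)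
  induction n with
  | zero => simp [hb, aeval_bell_zero_zero]
  | succ n ih =>
    -- The added term is zero because B_{n,n+1} = 0; the longer range matches the expansion for n +
    -- 1.
    have hd : ∑ k ∈ Finset.range (n + 1), mulX ^ k * S (d (b n k)) =
        ∑ k ∈ Finset.range (n + 1 + 1), mulX ^ k * S (d (b n k)) := by
      have hz : b n (n + 1) = 0 := aeval_bell_eq_zero_of_lt d g n.lt_succ_self
      rw [Finset.sum_range_succ _ (n + 1), hz, map_zero, map_zero, mul_zero, add_zero]
    have hs : ∀ k, b (n + 1) (k + 1) = d (b n (k + 1)) + b n k * d g :=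
      aeval_bell_succ_succ d g n
    have h0 : b (n + 1) 0 = d (b n 0) := aeval_bell_succ_zero d g n
    rw [pow_succ, ih, Finset.sum_mul]
    simp only [mul_assoc, S, d, g, hQ.seriesAt_mul_mulX_mul_derivative, mul_add,
      Finset.sum_add_distrib]
    change _ + ∑ k ∈ Finset.range (n + 1), mulX ^ k * S (d (b n k)) = _
    rw [hd, Finset.sum_range_succ' _ (n + 1), Finset.sum_range_succ' _ (n + 1), ← add_assoc,
      ← Finset.sum_add_distrib, h0]
    congr 1
    refine Finset.sum_congr rfl fun k _ => ?_
    rw [hs, map_add, mul_add, pow_succ, add_comm, mul_assoc, mul_assoc]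

end Rodrigues

end Umbral

theorem mainTheorem8 {K : Type*} [Field K] [CharZero K] (φ Q : Umbral.Op K)
    (h : Umbral.IsUmbral φ Q) :
    IsUnit (Umbral.pincherle Q) ∧
    Umbral.seriesAt (Umbral.indicator Q) Umbral.D = Q ∧
    (Umbral.indicator Q).subst (Umbral.compInverse (Umbral.indicator Q)) = PowerSeries.X ∧
    (Umbral.compInverse (Umbral.indicator Q)).subst (Umbral.indicator Q) = PowerSeries.X ∧
    ∀ n : ℕ,
      φ * Umbral.mulX ^ n = (Umbral.mulX * Ring.inverse (Umbral.pincherle Q)) ^ n * φ ∧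
      φ * Umbral.mulX ^ n =
        (∑ k ∈ Finset.range (n + 1), Umbral.mulX ^ k *
          Umbral.evalAt
            (fun j => Umbral.seriesAt
              ((PowerSeries.derivative K)^[j] (Umbral.compInverse (Umbral.indicator Q))) Q)
            (Umbral.bell K n k)) * φ := by
  have hQ := h.delta
  have key : ∀ n : ℕ,
      φ * Umbral.mulX ^ n = (Umbral.mulX * Ring.inverse (Umbral.pincherle Q)) ^ n * φ :=
    fun n => (SemiconjBy.pow_right (a := φ) h.mul_mulX n : _)
  refine ⟨hQ.isUnit_pincherle, hQ.seriesAt_indicator, hQ.indicator_subst_compInverse,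
    hQ.compInverse_subst_indicator, fun n => ⟨key n, ?_⟩⟩
  rw [key n, hQ.raising_pow n]
  congr 1
  refine Finset.sum_congr rfl fun k _ => ?_
  rw [← Umbral.evalAt_algHom]
  rfl
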